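/- Let $\ell\in\frac12\mathbb N=\{0,\frac12,1,\dots\}$. For $x\in[-1,1]$ let $W(x)=(W(x)_{n,m})_{n,m=0}^{2\ell}\in M_{2\ell+1}(\mathbb C)$ be the symmetric matrix given for $n\ge m$ by $$W(x)_{n,m}=\sqrt{1-x^2}\,\sum_{t=0}^m\alpha_t(m,n)\,U_{n+m-2t}(x),\qquad \alpha_t(m,n)=\frac{2\ell+1}{n+1}\,\frac{(2\ell-m)!\,m!}{(2\ell)!}\,(-1)^{m-t}\,\frac{(n-2\ell)_{m-t}}{(n+2)_{m-t}}\,\frac{(2\ell+2-t)_t}{t!},$$ where $U_k$ is the Chebyshev polynomial of the second kind and $(a)_k=a(a+1)\cdots(a+k-1)$. For $k=0,\dots,2\ell$ put $$c_k(\ell)=\frac{4^k(k!)^4(2k+1)}{((2k+1)!)^2}\,\frac{(2\ell+k+1)!\,(2\ell-k)!}{((2\ell)!)^2}.$$ Let $T^{j}$ be the irreducible representation of $\mathrm{SU}(2)$ on the space $H^{j}$ of homogeneous polynomials of degree $2j$ in two variables, given by $p(x,y)\mapsto p((x,y)g)$. For $\ell_1,\ell_2\in\frac12\mathbb N$ with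 $\ell_1+\ell_2=\ell$ let $T^{\ell_1,\ell_2}$ be the representation $T^{\ell_1}\otimes T^{\ell_2}$ of $\mathrm{SU}(2)\times\mathrm{SU}(2)$, and let $\Phi^\ell_{\ell_1,\ell_2}(u)=\pi\circ T^{\ell_1,\ell_2}(u)\circ\beta\in\mathrm{End}(H^\ell)$ be the spherical function, where $\beta\colon H^\ell\to H^{\ell_1}\otimes H^{\ell_2}$ and $\pi\colon H^{\ell_1}\otimes H^{\ell_2}\to H^\ell$ intertwine the actions of the diagonal subgroup $\mathrm{SU}(2)$ and $\pi\circ\beta=\mathrm{id}$ (this does not depend on the choice of $\beta,\pi$). Let $a_t=(\mathrm{diag}(e^{it/2},e^{-it/2}),\mathrm{diag}(e^{-it/2},e^{it/2}))$. Then $\Phi^\ell_{\ell_1,\ell_2}(a_t)$ is diagonal in the basis $x^{2\ell-j}y^{j}$, $0\le j\le 2\ell$. Let $\Phi_0(a_t)\in M_{2\ell+1}(\mathbb C)$ be the matrix whose $n$-th row, $0\le n\le2\ell$, consists of the diagonal entries of $\Phi^\ell_{\ell_1,\ell_2}(a_t)$ for $(\ell_1,\ell_2)=(\frac n2,\ell-\frac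 n2)$. Then the following hold. 1. For all $x\in[-1,1]$, $$\det W(x)=(1-x^2)^{2(\ell+\frac12)^2}\prod_{k=0}^{2\ell}c_k(\ell).$$ 2. $W(x)$ is invertible for all $x\in[-1,1]$ with $x\ne\pm1$. 3. $\Phi_0(a_t)$ is invertible for all $t\in\mathbb R$ with $x=\cos t\neq\pm1$. -/

import Mathlib

open scoped TensorProduct

namespace MVChebyshev

noncomputable section

/-! Throughout, the spin `ℓ ∈ ½ℕ` is encoded by the natural number `N = 2ℓ`. -/

/-- The coefficients `α_t(m,n)` of the weight; used for `t ≤ m ≤ n ≤ N`. -/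
def alpha (N t m n : ℕ) : ℝ :=
  ((N : ℝ) + 1) / ((n : ℝ) + 1) *
    (((N - m).factorial : ℝ) * (m.factorial : ℝ) / (N.factorial : ℝ)) *
    (-1) ^ (m - t) *
    ((ascPochhammer ℝ (m - t)).eval ((n : ℝ) - (N : ℝ)) /
      (ascPochhammer ℝ (m - t)).eval ((n : ℝ) + 2)) *
    ((ascPochhammer ℝ t).eval ((N : ℝ) + 2 - (t : ℝ)) / (t.factorial : ℝ))

/-- The entry `W(x)_{n,m}` for `m ≤ n`. -/
def weightLower (N n m : ℕ) (x : ℝ) : ℝ :=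
  Real.sqrt (1 - x ^ 2) *
    ∑ t ∈ Finset.range (m + 1),
      alpha N t m n * (Polynomial.Chebyshev.U ℝ ((n : ℤ) + m - 2 * t)).eval x

/-- The matrix weight `W : [-1,1] → M_{2ℓ+1}(ℂ)`. -/
def W (N : ℕ) (x : ℝ) : Matrix (Fin (N + 1)) (Fin (N + 1)) ℂ :=
  Matrix.of fun n m =>
    ((if m ≤ n then weightLower N n m x else weightLower N m n x : ℝ) : ℂ)

/-- The constants `c_k(ℓ)`, `ℓ = N / 2`; used for `k ≤ N`. -/
def c (N k : ℕ) : ℝ :=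
  4 ^ k * (k.factorial : ℝ) ^ 4 * (2 * (k : ℝ) + 1) / ((2 * k + 1).factorial : ℝ) ^ 2 *
    (((N + k + 1).factorial : ℝ) * ((N - k).factorial : ℝ) / (N.factorial : ℝ) ^ 2)

/-- The group `SU(2)`. -/
abbrev SU2 : Type := Matrix.specialUnitaryGroup (Fin 2) ℂ

/-- The representation space `H^ℓ`, `ℓ = N / 2`: homogeneous polynomials of degree `N` in two
variables. -/
abbrev H (N : ℕ) : Type := MvPolynomial.homogeneousSubmodule (Fin 2) ℂ N

/-- The linear substitution attached to a matrix, `X_j ↦ ∑_i g_{ij} X_i`, that is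
`p(x,y) ↦ p((x,y)g)`. -/
def subst (g : Matrix (Fin 2) (Fin 2) ℂ) :
    MvPolynomial (Fin 2) ℂ →ₐ[ℂ] MvPolynomial (Fin 2) ℂ :=
  MvPolynomial.aeval fun j => ∑ i, g i j • (MvPolynomial.X i : MvPolynomial (Fin 2) ℂ)

theorem subst_isHomogeneous (g : Matrix (Fin 2) (Fin 2) ℂ) {N : ℕ}
    {p : MvPolynomial (Fin 2) ℂ} (hp : p.IsHomogeneous N) : (subst g p).IsHomogeneous N := by
  have h := MvPolynomial.IsHomogeneous.aeval hp (n := 1)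
    (fun j => ∑ i, g i j • (MvPolynomial.X i : MvPolynomial (Fin 2) ℂ)) (fun j => by
      refine MvPolynomial.IsHomogeneous.sum _ _ _ fun i _ => ?_
      rw [MvPolynomial.smul_eq_C_mul]
      exact (MvPolynomial.isHomogeneous_X ℂ i).C_mul _)
  simpa [subst] using h

theorem subst_one : subst 1 = AlgHom.id ℂ _ := by
  apply MvPolynomial.algHom_ext
  intro j
  fin_cases j <;> simp [subst]

theorem subst_mul (g h : Matrix (Fin 2) (Fin 2) ℂ) :
    subst (g * h) = (subst g).comp (subst h) := by
  apply MvPolynomial.algHom_ext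
  intro j
  simp only [subst, MvPolynomial.aeval_X, AlgHom.comp_apply, Matrix.mul_apply, map_sum, map_smul,
    Finset.smul_sum, Finset.sum_smul, smul_smul]
  rw [Finset.sum_comm]
  simp only [mul_comm]

/-- The irreducible representation `T^ℓ` of `SU(2)` on `H^ℓ`, `ℓ = N / 2`. -/
def T (N : ℕ) : Representation ℂ SU2 (H N) where
  toFun g := (subst g.1).toLinearMap.restrict fun _ hp => subst_isHomogeneous g.1 hp
  map_one' := by
    ext p : 2
    simp [subst_one]
  map_mul' g h := by
    ext p : 2
    simp [subst_mul]
    rfl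

/-- The irreducible representation `T^{ℓ₁,ℓ₂}` of `SU(2) × SU(2)` on `H^{ℓ₁} ⊗ H^{ℓ₂}`,
`ℓ₁ = n / 2`, `ℓ₂ = m / 2`. The subgroup `K` is the diagonal `{(k,k)}`. -/
def T₂ (n m : ℕ) : Representation ℂ (SU2 × SU2) (H n ⊗[ℂ] H m) where
  toFun u := TensorProduct.map (T n u.1) (T m u.2)
  map_one' := by simp
  map_mul' u v := by simp [TensorProduct.map_mul]

/-- The exponent of `x^{N-k} y^k`. -/
def expo (N k : ℕ) : Fin 2 →₀ ℕ := Finsupp.single 0 (N - k) + Finsupp.single 1 k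

/-- The weight vector `x^{N-k} y^k` of `H^ℓ`. -/
def mono (N : ℕ) (k : Fin (N + 1)) : H N :=
  ⟨MvPolynomial.monomial (expo N k) 1, by
    have hk : (k : ℕ) ≤ N := Nat.lt_succ_iff.mp k.2
    rw [MvPolynomial.mem_homogeneousSubmodule]
    apply MvPolynomial.isHomogeneous_monomial
    rw [expo, map_add, Finsupp.degree_single, Finsupp.degree_single]
    omega⟩

/-- Multiplication of polynomials as a map `H^{ℓ₁} ⊗ H^{ℓ₂} → H^ℓ`, `ℓ = ℓ₁ + ℓ₂`. -/
def proj {n m N : ℕ} (h : n + m = N) : H n ⊗[ℂ] H m →ₗ[ℂ] H N :=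
  TensorProduct.lift (LinearMap.mk₂ ℂ
    (fun p q => (⟨p.1 * q.1, h ▸ MvPolynomial.IsHomogeneous.mul p.2 q.2⟩ : H N))
    (fun _ _ _ => Subtype.ext (add_mul _ _ _))
    (fun r _ _ => Subtype.ext (smul_mul_assoc r _ _))
    (fun _ _ _ => Subtype.ext (mul_add _ _ _))
    (fun r _ _ => Subtype.ext (mul_smul_comm r _ _)))

/-- Polarization `H^ℓ → H^{ℓ₁} ⊗ H^{ℓ₂}`, `ℓ = ℓ₁ + ℓ₂`: the linear map with
`(a x + b y)^N ↦ (a x + b y)^n ⊗ (a x + b y)^m`, written out on coefficients. -/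
def emb (n m N : ℕ) : H N →ₗ[ℂ] H n ⊗[ℂ] H m :=
  ∑ j : Fin (n + 1), ∑ k : Fin (m + 1),
    ((MvPolynomial.lcoeff ℂ (expo N (j + k))).comp
      (MvPolynomial.homogeneousSubmodule (Fin 2) ℂ N).subtype).smulRight
        (((n.choose j : ℂ) * (m.choose k : ℂ) / (N.choose (j + k) : ℂ)) •
          (mono n j ⊗ₜ[ℂ] mono m k))

theorem proj_tmul {n m N : ℕ} (h : n + m = N) (p : H n) (q : H m) :
    (proj h (p ⊗ₜ[ℂ] q) : MvPolynomial (Fin 2) ℂ) = p.1 * q.1 := rfl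

theorem emb_apply (n m N : ℕ) (f : H N) :
    emb n m N f = ∑ j : Fin (n + 1), ∑ k : Fin (m + 1),
      MvPolynomial.coeff (expo N (j + k)) f.1 •
        (((n.choose j : ℂ) * (m.choose k : ℂ) / (N.choose (j + k) : ℂ)) •
          (mono n j ⊗ₜ[ℂ] mono m k)) := by
  simp [emb, LinearMap.sum_apply]

theorem expo_injective {N i k : ℕ} (h : expo N i = expo N k) : i = k := by
  have := DFunLike.congr_fun h 1
  simpa [expo] using this

theorem sum_mono (N : ℕ) (f : H N) :
    f = ∑ k : Fin (N + 1), MvPolynomial.coeff (expo N k) f.1 • mono N k := by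
  apply Subtype.ext
  ext d
  simp only [Submodule.coe_sum, Submodule.coe_smul, MvPolynomial.coeff_sum,
    MvPolynomial.coeff_smul, mono, MvPolynomial.coeff_monomial, smul_eq_mul, mul_ite, mul_one,
    mul_zero]
  by_cases hd : d.degree = N
  · have hd' : d 0 + d 1 = N := by
      rw [← hd, Finsupp.degree_eq_sum, Fin.sum_univ_two]
    have he : expo N (d 1) = d := by
      ext i
      fin_cases i <;> simp [expo]
      omega
    rw [Finset.sum_eq_single (⟨d 1, by omega⟩ : Fin (N + 1))]
    · simp [he]
    · intro b _ hb
      rw [if_neg]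
      intro hbd
      exact hb (Fin.ext (expo_injective (hbd.trans he.symm)))
    · simp
  · have h0 : MvPolynomial.coeff d f.1 = 0 :=
      MvPolynomial.IsHomogeneous.coeff_eq_zero f.2 hd
    rw [h0]
    symm
    apply Finset.sum_eq_zero
    intro k _
    rw [if_neg]
    intro hk
    apply hd
    have hk' : (k : ℕ) ≤ N := Nat.lt_succ_iff.mp k.2
    rw [← hk, expo, map_add, Finsupp.degree_single, Finsupp.degree_single]
    omega

/-- The element `(a x + b y)^N` of `H^ℓ`. -/
def linPow (N : ℕ) (a b : ℂ) : H N :=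
  ⟨(a • MvPolynomial.X 0 + b • MvPolynomial.X 1) ^ N, by
    have h : (a • MvPolynomial.X 0 + b • MvPolynomial.X 1 :
        MvPolynomial (Fin 2) ℂ).IsHomogeneous 1 := by
      rw [MvPolynomial.smul_eq_C_mul, MvPolynomial.smul_eq_C_mul]
      exact ((MvPolynomial.isHomogeneous_X ℂ 0).C_mul a).add
        ((MvPolynomial.isHomogeneous_X ℂ 1).C_mul b)
    simpa using h.pow N⟩

theorem linPow_eq (N : ℕ) (a b : ℂ) :
    linPow N a b = ∑ k : Fin (N + 1),
      ((N.choose k : ℂ) * a ^ (N - (k : ℕ)) * b ^ (k : ℕ)) • mono N k := by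
  apply Subtype.ext
  simp only [linPow, Submodule.coe_sum, Submodule.coe_smul, mono]
  rw [add_comm, add_pow, ← Fin.sum_univ_eq_sum_range
    (fun k => (b • MvPolynomial.X 1 : MvPolynomial (Fin 2) ℂ) ^ k *
      (a • MvPolynomial.X 0) ^ (N - k) * (N.choose k : MvPolynomial (Fin 2) ℂ))]
  refine Finset.sum_congr rfl fun k _ => ?_
  have h1 : (MvPolynomial.monomial (expo N k) (1 : ℂ)) =
      MvPolynomial.X 0 ^ (N - (k : ℕ)) * MvPolynomial.X 1 ^ (k : ℕ) := by
    rw [MvPolynomial.X_pow_eq_monomial, MvPolynomial.X_pow_eq_monomial,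
      MvPolynomial.monomial_mul, one_mul, expo]
  rw [h1]
  simp only [MvPolynomial.smul_eq_C_mul, mul_pow, map_mul, map_pow, map_natCast]
  ring

theorem coeff_linPow (N : ℕ) (a b : ℂ) {k : ℕ} (hk : k ≤ N) :
    MvPolynomial.coeff (expo N k) (linPow N a b).1 =
      (N.choose k : ℂ) * a ^ (N - k) * b ^ k := by
  rw [linPow_eq]
  simp only [Submodule.coe_sum, Submodule.coe_smul, MvPolynomial.coeff_sum,
    MvPolynomial.coeff_smul, mono, MvPolynomial.coeff_monomial, smul_eq_mul, mul_ite, mul_one,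
    mul_zero]
  rw [Finset.sum_eq_single (⟨k, by omega⟩ : Fin (N + 1))]
  · simp
  · intro i _ hi
    rw [if_neg]
    intro h
    exact hi (Fin.ext (expo_injective h))
  · simp

theorem ext_linPow {N : ℕ} {E : Type*} [AddCommGroup E] [Module ℂ E] {F G : H N →ₗ[ℂ] E}
    (h : ∀ b, F (linPow N 1 b) = G (linPow N 1 b)) : F = G := by
  have key : ∀ k : Fin (N + 1), (F - G) (mono N k) = 0 := by
    intro k
    rw [← Module.forall_dual_apply_eq_zero_iff ℂ]
    intro φ
    let P : Polynomial ℂ := ∑ i : Fin (N + 1),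
      Polynomial.C ((N.choose i : ℂ) * φ ((F - G) (mono N i))) * Polynomial.X ^ (i : ℕ)
    have hP : P = 0 := by
      apply Polynomial.funext
      intro b
      have hb : φ ((F - G) (linPow N 1 b)) = 0 := by simp [h b]
      rw [linPow_eq] at hb
      simp only [map_sum, map_smul, smul_eq_mul, one_pow, mul_one] at hb
      simp only [P, Polynomial.eval_finsetSum, Polynomial.eval_mul, Polynomial.eval_C,
        Polynomial.eval_pow, Polynomial.eval_X, Polynomial.eval_zero]
      rw [← hb]
      exact Finset.sum_congr rfl fun i _ => by ring
    have hc := congrArg (fun p => Polynomial.coeff p (k : ℕ)) hP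
    simp only [P, Polynomial.finsetSum_coeff, Polynomial.coeff_C_mul, Polynomial.coeff_X_pow,
      Polynomial.coeff_zero, mul_ite, mul_one, mul_zero] at hc
    rw [Finset.sum_eq_single k (fun i _ hi => if_neg fun h => hi (Fin.ext h.symm))
      (by simp), if_pos rfl] at hc
    have hk : (N.choose (k : ℕ) : ℂ) ≠ 0 :=
      Nat.cast_ne_zero.mpr (Nat.choose_pos (Nat.lt_succ_iff.mp k.2)).ne'
    exact (mul_eq_zero.mp hc).resolve_left hk
  rw [← sub_eq_zero]
  ext f : 1
  rw [sum_mono N f]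
  simp only [map_sum, map_smul, key, smul_zero, Finset.sum_const_zero, LinearMap.zero_apply]

theorem emb_linPow {n m N : ℕ} (h : n + m = N) (a b : ℂ) :
    emb n m N (linPow N a b) = linPow n a b ⊗ₜ[ℂ] linPow m a b := by
  rw [emb_apply, linPow_eq n, linPow_eq m, TensorProduct.sum_tmul]
  refine Finset.sum_congr rfl fun j _ => ?_
  rw [TensorProduct.tmul_sum]
  refine Finset.sum_congr rfl fun k _ => ?_
  have hj : (j : ℕ) ≤ n := Nat.lt_succ_iff.mp j.2
  have hk : (k : ℕ) ≤ m := Nat.lt_succ_iff.mp k.2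
  have hjk : (j : ℕ) + k ≤ N := by omega
  have hc : (N.choose ((j : ℕ) + k) : ℂ) ≠ 0 :=
    Nat.cast_ne_zero.mpr (Nat.choose_pos hjk).ne'
  rw [coeff_linPow N a b hjk, TensorProduct.smul_tmul_smul, smul_smul]
  congr 1
  have hs : N - ((j : ℕ) + k) = (n - j) + (m - k) := by omega
  rw [hs, pow_add, pow_add]
  field_simp

theorem T_coe (N : ℕ) (g : SU2) (p : H N) :
    (T N g p : MvPolynomial (Fin 2) ℂ) = subst g.1 p.1 := rfl

theorem T₂_tmul (n m : ℕ) (u : SU2 × SU2) (p : H n) (q : H m) :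
    T₂ n m u (p ⊗ₜ[ℂ] q) = T n u.1 p ⊗ₜ[ℂ] T m u.2 q := rfl

theorem T_linPow (N : ℕ) (g : SU2) (a b : ℂ) :
    T N g (linPow N a b) =
      linPow N (g.1 0 0 * a + g.1 0 1 * b) (g.1 1 0 * a + g.1 1 1 * b) := by
  apply Subtype.ext
  rw [T_coe]
  simp only [linPow]
  rw [map_pow]
  congr 1
  simp only [subst, map_add, map_smul, MvPolynomial.aeval_X, Fin.sum_univ_two]
  module

/-- `emb` intertwines the actions of `K`. -/
theorem emb_equivariant {n m N : ℕ} (h : n + m = N) (k : SU2) :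
    (emb n m N).comp (T N k) = (T₂ n m (k, k)).comp (emb n m N) := by
  refine ext_linPow (E := H n ⊗[ℂ] H m) fun b => ?_
  rw [LinearMap.comp_apply, LinearMap.comp_apply, T_linPow, emb_linPow h, emb_linPow h,
    T₂_tmul, T_linPow, T_linPow]

/-- `proj` intertwines the actions of `K`. -/
theorem proj_equivariant {n m N : ℕ} (h : n + m = N) (k : SU2) :
    (proj h).comp (T₂ n m (k, k)) = (T N k).comp (proj h) := by
  apply TensorProduct.ext'
  intro p q
  apply Subtype.ext
  rw [LinearMap.comp_apply, LinearMap.comp_apply, T₂_tmul, proj_tmul, T_coe, T_coe, T_coe,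
    proj_tmul, map_mul]

theorem proj_comp_emb {n m N : ℕ} (h : n + m = N) :
    (proj h).comp (emb n m N) = LinearMap.id := by
  apply ext_linPow
  intro b
  rw [LinearMap.comp_apply, emb_linPow h]
  apply Subtype.ext
  rw [proj_tmul]
  change (_ : MvPolynomial (Fin 2) ℂ) ^ n * _ ^ m = _ ^ N
  rw [← pow_add, h]

/-- The spherical function `Φ^ℓ_{ℓ₁,ℓ₂} : SU(2) × SU(2) → End(H^ℓ)`, for `ℓ₁ = n / 2`,
`ℓ₂ = m / 2`, `ℓ = N / 2 = ℓ₁ + ℓ₂`: the `T^ℓ`-isotypical part of `T^{ℓ₁,ℓ₂}`, that is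
`u ↦ π ∘ T^{ℓ₁,ℓ₂}(u) ∘ β` with `K`-intertwiners `β : H^ℓ → H^{ℓ₁} ⊗ H^{ℓ₂}` and
`π : H^{ℓ₁} ⊗ H^{ℓ₂} → H^ℓ` such that `π ∘ β = 1`
(see `emb_equivariant`, `proj_equivariant`, `proj_comp_emb`). As `T^ℓ` occurs exactly once in
`T^{ℓ₁,ℓ₂}` restricted to `K`, the result does not depend on the choice of `β` and `π`. -/
def spherical {n m N : ℕ} (h : n + m = N) (u : SU2 × SU2) : H N →ₗ[ℂ] H N :=
  (proj h).comp ((T₂ n m u).comp (emb n m N))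

/-- The diagonal matrix with entries `e^{is}`, `e^{-is}`. -/
def torus (s : ℝ) : SU2 :=
  ⟨Matrix.diagonal ![Complex.exp (Complex.I * s), Complex.exp (-(Complex.I * s))], by
    rw [Matrix.mem_specialUnitaryGroup_iff, Matrix.mem_unitaryGroup_iff]
    constructor
    · rw [Matrix.star_eq_conjTranspose, Matrix.diagonal_conjTranspose, Matrix.diagonal_mul_diagonal,
        ← Matrix.diagonal_one]
      congr 1
      funext i
      fin_cases i <;> simp [← Complex.exp_conj, ← Complex.exp_add]
    · simp [Matrix.det_diagonal, ← Complex.exp_add]⟩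

/-- The element `a_t` of the subgroup `A`. -/
def aElt (t : ℝ) : SU2 × SU2 := (torus (t / 2), torus (-(t / 2)))

/-- The full spherical function `Φ_0` of type `ℓ = N / 2` and degree `0`, at `a_t`. The row with
index `n` belongs to `(ℓ₁, ℓ₂) = (n / 2, (N - n) / 2)`, i.e. to `½ (ℓ + h, ℓ - h)` with
`h = n - ℓ`. It consists of the entries of `Φ^ℓ_{ℓ₁,ℓ₂}(a_t)`, which commutes with the diagonal
torus of `K` and hence is diagonal in the weight basis `x^{N-j} y^j`. -/
def fullSpherical (N : ℕ) (t : ℝ) : Matrix (Fin (N + 1)) (Fin (N + 1)) ℂ :=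
  Matrix.of fun n j =>
    MvPolynomial.coeff (expo N j)
      (spherical (Nat.add_sub_of_le (Nat.lt_succ_iff.mp n.2)) (aElt t) (mono N j)).1

end

end MVChebyshev

/-! Everything reduces to one matrix: `symPow N p q`, the substitution (1, X) ↦ (1 + qX, 1 + pX) on
polynomials of degree at most N, with determinant (p - q)^(N(N+1)/2).

For x = cos θ put p = e^{iθ}, q = e^{-iθ}. Then W(x) = sin θ · D Sᵀ S' D, where S = `symPow N p q`,
S' = `symPow N q p` and D is the diagonal matrix of inverse binomials (`W_cos`). To see this, view
the entries of Sᵀ S' as coefficients of K(u,v) = ∑ₖ (1+pu)^k (1+qu)^(N-k) (1+qv)^k (1+pv)^(N-k).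
Since (1+pu)(1+qv) - (1+qu)(1+pv) = (p-q)(u-v), the sum (p-q)(u-v)K telescopes to a difference of
two (N+1)-st powers. Dividing by u - v on coefficients gives sums of products of binomials with p^a
q^b - q^a p^b, that is, Chebyshev values (`kernelCoeff_eq_sum`, `alpha_mul_choose`). The determinant
follows once ∏ c_k is evaluated (`prod_c`), and invertibility away from ±1 follows from it.

The matrix Φ_0(a_t) is also an invertible diagonal matrix times a `symPow` times D
(`fullSpherical_eq`), so it is invertible when e^{it} ≠ e^{-it}. -/

open Polynomial in
/-- The matrix whose `k`-th row holds the coefficients of `(1 + p X) ^ k (1 + q X) ^ (N - k)`. -/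
noncomputable def symPow (N : ℕ) (p q : ℂ) : Matrix (Fin (N + 1)) (Fin (N + 1)) ℂ :=
  Matrix.of fun k j =>
    ((1 + C p * X : ℂ[X]) ^ (k : ℕ) * (1 + C q * X) ^ (N - (k : ℕ))).coeff j

/-! ### The determinant of `symPow` -/

section symPow
open Polynomial

theorem natDegree_linear_pow_mul_le {N k : ℕ} (hk : k ≤ N) (p q : ℂ) :
    ((1 + C p * X : ℂ[X]) ^ k * (1 + C q * X) ^ (N - k)).natDegree ≤ N := by
  have h : ∀ r : ℂ, (1 + C r * X : ℂ[X]).natDegree ≤ 1 := fun r => by compute_degree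
  refine natDegree_mul_le.trans ?_
  have h1 := natDegree_pow_le_of_le k (h p)
  have h2 := natDegree_pow_le_of_le (N - k) (h q)
  omega

/-- Evaluating the row polynomials at N + 1 distinct nodes gives a homogeneous Vandermonde matrix
whose pairwise factors are (p - q)(v_j - v_i). Cancelling the ordinary Vandermonde leaves one p - q
for each pair of nodes. -/
theorem det_symPow (N : ℕ) (p q : ℂ) :
    (symPow N p q).det = (p - q) ^ (N * (N + 1) / 2) := by
  let v : Fin (N + 1) → ℂ := fun i => ((i : ℕ) : ℂ)
  have hv : Function.Injective v := fun i j h => Fin.ext (Nat.cast_injective h)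
  have hmul : Matrix.vandermonde v * (symPow N p q).transpose =
      Matrix.projVandermonde (fun i => 1 + p * v i) (fun i => 1 + q * v i) := by
    ext i k
    have hk : (k : ℕ) ≤ N := Nat.lt_succ_iff.mp k.2
    have h := eval_eq_sum_range' (Nat.lt_succ_iff.mpr (natDegree_linear_pow_mul_le hk p q)) (v i)
    rw [Matrix.mul_apply, Matrix.projVandermonde_apply, Fin.val_rev,
      show N + 1 - ((k : ℕ) + 1) = N - k by omega]
    simp only [eval_mul, eval_pow, eval_add, eval_one, eval_C, eval_X] at h
    rw [h, Finset.sum_range]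
    refine Finset.sum_congr rfl fun j _ => ?_
    simp only [Matrix.vandermonde_apply, Matrix.transpose_apply, symPow, Matrix.of_apply]
    ring
  have hdet := congrArg Matrix.det hmul
  rw [Matrix.det_mul, Matrix.det_transpose, Matrix.det_projVandermonde] at hdet
  refine mul_left_cancel₀ (Matrix.det_vandermonde_ne_zero_iff.mpr hv) ?_
  rw [hdet, Matrix.det_vandermonde]
  have hexp : (p - q) ^ (N * (N + 1) / 2) = ∏ i : Fin (N + 1), ∏ _j ∈ Finset.Ioi i, (p - q) := by
    simp only [Finset.prod_const, Fin.card_Ioi]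
    rw [Finset.prod_pow_eq_pow_sum, Fin.sum_univ_eq_sum_range (fun i => N + 1 - 1 - i),
      Finset.sum_range_reflect (fun i => i) (N + 1), Finset.sum_range_id]
    congr 1
    rw [mul_comm]; simp
  rw [hexp, ← Finset.prod_mul_distrib]
  refine Finset.prod_congr rfl fun i _ => ?_
  rw [← Finset.prod_mul_distrib]
  refine Finset.prod_congr rfl fun j _ => ?_
  ring

/-! ### The telescoping kernel -/

theorem coeff_linear_pow (M n : ℕ) (p : ℂ) :
    ((1 + C p * X : ℂ[X]) ^ M).coeff n = M.choose n * p ^ n := by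
  have h : (1 + C p * X : ℂ[X]) ^ M = ((1 + X : ℂ[X]) ^ M).comp (C p * X) := by simp
  rw [h, comp_C_mul_X_coeff, coeff_one_add_X_pow]

theorem coeff_succ_linear_mul (r : ℂ) (g : ℂ[X]) (n : ℕ) :
    ((1 + C r * X) * g).coeff (n + 1) = g.coeff (n + 1) + r * g.coeff n := by
  rw [add_mul, one_mul, mul_assoc, coeff_add, coeff_C_mul, coeff_X_mul]

theorem coeff_zero_linear_mul (r : ℂ) (g : ℂ[X]) :
    ((1 + C r * X) * g).coeff 0 = g.coeff 0 := by
  simp [add_mul, mul_assoc]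

/-- The coefficient of `u ^ n v ^ m` in the kernel
`∑ k, (1 + p u) ^ k (1 + q u) ^ (N - k) (1 + q v) ^ k (1 + p v) ^ (N - k)`. -/
noncomputable def kernelCoeff (N : ℕ) (p q : ℂ) (n m : ℕ) : ℂ :=
  ∑ k ∈ Finset.range (N + 1),
    ((1 + C p * X : ℂ[X]) ^ k * (1 + C q * X) ^ (N - k)).coeff n *
      ((1 + C q * X : ℂ[X]) ^ k * (1 + C p * X) ^ (N - k)).coeff m

theorem symPow_transpose_mul_apply (N : ℕ) (p q : ℂ) (n m : Fin (N + 1)) :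
    ((symPow N p q).transpose * symPow N q p) n m = kernelCoeff N p q n m := by
  rw [Matrix.mul_apply, kernelCoeff, Finset.sum_range]
  rfl

/-- The reflection k ↦ N - k exchanges the roles of u and v in the kernel. -/
theorem kernelCoeff_comm (N : ℕ) (p q : ℂ) (n m : ℕ) :
    kernelCoeff N p q n m = kernelCoeff N p q m n := by
  rw [kernelCoeff, ← Finset.sum_range_reflect, kernelCoeff]
  refine Finset.sum_congr rfl fun k hk => ?_
  have hk' : k ≤ N := Nat.lt_succ_iff.mp (Finset.mem_range.mp hk)
  rw [show N + 1 - 1 - k = N - k by omega, show N - (N - k) = k by omega,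
    mul_comm ((1 + C p * X : ℂ[X]) ^ (N - k)), mul_comm ((1 + C q * X : ℂ[X]) ^ (N - k)), mul_comm]

/-- The k-th term is f (k+1) - f k, where f k is the coefficient of u^n v^m in ((1+pu)(1+qv))^k
((1+qu)(1+pv))^(N+1-k). Only the two pure powers survive. -/
theorem sum_shift_eq (N : ℕ) (p q : ℂ) (n m : ℕ) :
    ∑ k ∈ Finset.range (N + 1),
      (((1 + C p * X) * ((1 + C p * X : ℂ[X]) ^ k * (1 + C q * X) ^ (N - k))).coeff n *
        ((1 + C q * X) * ((1 + C q * X : ℂ[X]) ^ k * (1 + C p * X) ^ (N - k))).coeff m -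
      ((1 + C q * X) * ((1 + C p * X : ℂ[X]) ^ k * (1 + C q * X) ^ (N - k))).coeff n *
        ((1 + C p * X) * ((1 + C q * X : ℂ[X]) ^ k * (1 + C p * X) ^ (N - k))).coeff m) =
    ((N + 1).choose n * (N + 1).choose m : ℂ) * (p ^ n * q ^ m - q ^ n * p ^ m) := by
  let f : ℕ → ℂ := fun k => ((1 + C p * X : ℂ[X]) ^ k * (1 + C q * X) ^ (N + 1 - k)).coeff n *
    ((1 + C q * X : ℂ[X]) ^ k * (1 + C p * X) ^ (N + 1 - k)).coeff m
  have h : f (N + 1) - f 0 =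
      ((N + 1).choose n * (N + 1).choose m : ℂ) * (p ^ n * q ^ m - q ^ n * p ^ m) := by
    simp only [f, Nat.sub_self, Nat.sub_zero, pow_zero, mul_one, one_mul, coeff_linear_pow]
    ring
  rw [← h, ← Finset.sum_range_sub]
  refine Finset.sum_congr rfl fun k hk => ?_
  have hk' : k ≤ N := Nat.lt_succ_iff.mp (Finset.mem_range.mp hk)
  have e1 : N + 1 - (k + 1) = N - k := by omega
  have e2 : N + 1 - k = (N - k) + 1 := by omega
  simp only [f, e1, e2]
  congr 3 <;> ring_nf

theorem kernelCoeff_zero (N : ℕ) (p q : ℂ) (n : ℕ) :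
    (p - q) * kernelCoeff N p q n 0 =
      ((N + 1).choose (n + 1) * (N + 1).choose 0 : ℂ) *
        (p ^ (n + 1) * q ^ 0 - q ^ (n + 1) * p ^ 0) := by
  rw [← sum_shift_eq, kernelCoeff, Finset.mul_sum]
  refine Finset.sum_congr rfl fun k _ => ?_
  rw [coeff_succ_linear_mul, coeff_succ_linear_mul, coeff_zero_linear_mul, coeff_zero_linear_mul]
  ring

/-- This compares coefficients of u^(n+1) v^(m+1) in the telescoped identity for (p-q)(u-v)K. It is
a recursion along the antidiagonals n + m = const, started by `kernelCoeff_zero`. -/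
theorem kernelCoeff_succ (N : ℕ) (p q : ℂ) (n m : ℕ) :
    (p - q) * kernelCoeff N p q n (m + 1) = (p - q) * kernelCoeff N p q (n + 1) m +
      ((N + 1).choose (n + 1) * (N + 1).choose (m + 1) : ℂ) *
        (p ^ (n + 1) * q ^ (m + 1) - q ^ (n + 1) * p ^ (m + 1)) := by
  rw [← sum_shift_eq, kernelCoeff, kernelCoeff, Finset.mul_sum, Finset.mul_sum,
    ← Finset.sum_add_distrib]
  refine Finset.sum_congr rfl fun k _ => ?_
  simp only [coeff_succ_linear_mul]
  ring

theorem kernelCoeff_eq_sum (N : ℕ) (p q : ℂ) (m n : ℕ) :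
    (p - q) * kernelCoeff N p q n m = ∑ t ∈ Finset.range (m + 1),
      ((N + 1).choose (n + m + 1 - t) * (N + 1).choose t : ℂ) *
        (p ^ (n + m + 1 - t) * q ^ t - q ^ (n + m + 1 - t) * p ^ t) := by
  induction m generalizing n with
  | zero => rw [kernelCoeff_zero]; simp
  | succ m ih =>
    rw [kernelCoeff_succ, ih, Finset.sum_range_succ _ (m + 1),
      show n + (m + 1) + 1 - (m + 1) = n + 1 by omega, show n + 1 + m + 1 = n + (m + 1) + 1 by omega]

end symPow

/-! ### The product of the constants c_k -/

/-- Both sides are ∏ f j over j < 2M, paired symmetrically about the middle on the left and by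
neighbours on the right. -/
theorem prod_range_reflect_mul_shift {R : Type*} [CommMonoid R] (f : ℕ → R) (M : ℕ) :
    ∏ k ∈ Finset.range M, (f (M + k) * f (M - 1 - k)) =
      ∏ k ∈ Finset.range M, (f (2 * k + 1) * f (2 * k)) := by
  have h : ∀ M, ∏ j ∈ Finset.range (2 * M), f j =
      ∏ k ∈ Finset.range M, (f (2 * k + 1) * f (2 * k)) := by
    intro M
    induction M with
    | zero => simp
    | succ M ih =>
      rw [Finset.prod_range_succ, ← ih, show 2 * (M + 1) = 2 * M + 1 + 1 by ring,
        Finset.prod_range_succ, Finset.prod_range_succ, mul_assoc, mul_comm (f (2 * M))]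
  rw [← h, Finset.prod_mul_distrib, Finset.prod_range_reflect, two_mul, Finset.prod_range_add,
    mul_comm]

theorem choose_mul_descFactorial (M k i : ℕ) :
    M.choose k * (M - k).descFactorial i = M.choose (k + i) * (k + 1).ascFactorial i := by
  refine Nat.eq_of_mul_eq_mul_left k.factorial_pos ?_
  have h := Nat.descFactorial_mul_descFactorial (n := M) (Nat.le_add_right k i)
  rw [Nat.add_sub_cancel_left] at h
  rw [← mul_assoc, ← Nat.descFactorial_eq_factorial_mul_choose, mul_comm, h,
    Nat.descFactorial_eq_factorial_mul_choose, ← Nat.factorial_mul_ascFactorial]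
  ring

namespace MVChebyshev

/-- The last two fractions each have product 1 over k ≤ N, the first by
`prod_range_reflect_mul_shift` and the second by reflection. The form `N + 1 - 1 - k` matches those
lemmas at M = N + 1. -/
theorem c_eq {N k : ℕ} (hk : k ≤ N) :
    c N k = 4 ^ k * ((N.choose k : ℝ) ^ 2)⁻¹ *
      (((N + 1 + k).factorial * (N + 1 - 1 - k).factorial : ℝ) /
        ((2 * k + 1).factorial * (2 * k).factorial : ℝ)) *
      ((k.factorial : ℝ) ^ 2 / ((N + 1 - 1 - k).factorial : ℝ) ^ 2) := by
  have hN : N + k + 1 = N + 1 + k := by omega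
  rw [c, Nat.cast_choose ℝ hk, hN, Nat.add_sub_cancel, Nat.factorial_succ (2 * k)]
  push_cast
  have h1 := Nat.cast_ne_zero (R := ℝ).mpr (N - k).factorial_ne_zero
  have h2 := Nat.cast_ne_zero (R := ℝ).mpr N.factorial_ne_zero
  have h3 := Nat.cast_ne_zero (R := ℝ).mpr k.factorial_ne_zero
  have h4 := Nat.cast_ne_zero (R := ℝ).mpr (2 * k).factorial_ne_zero
  have h5 : (2 * (k : ℝ) + 1) ≠ 0 := by positivity
  field_simp

theorem prod_c (N : ℕ) :
    ∏ k ∈ Finset.range (N + 1), c N k =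
      4 ^ (N * (N + 1) / 2) * ∏ k ∈ Finset.range (N + 1), ((N.choose k : ℝ) ^ 2)⁻¹ := by
  rw [Finset.prod_congr rfl fun k hk => c_eq (Nat.lt_succ_iff.mp (Finset.mem_range.mp hk)),
    Finset.prod_mul_distrib, Finset.prod_mul_distrib, Finset.prod_mul_distrib,
    Finset.prod_div_distrib, Finset.prod_div_distrib,
    prod_range_reflect_mul_shift (fun j => (j.factorial : ℝ)),
    Finset.prod_range_reflect (fun j => (j.factorial : ℝ) ^ 2), div_self, div_self, mul_one,
    mul_one, Finset.prod_pow_eq_pow_sum, Finset.sum_range_id]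
  · rw [Nat.succ_sub_one, mul_comm N]
  · exact Finset.prod_ne_zero_iff.mpr fun k _ => by positivity
  · exact Finset.prod_ne_zero_iff.mpr fun k _ => by positivity

/-! ### The coefficients α_t as products of binomials -/

/-- With i = m - t, the symbol (n-N)_i is (-1)^i times a falling factorial of N - n, which cancels
the sign in α. The Pochhammer quotient then moves the lower index of the binomial from n + 1 to n +
1 + i. -/
theorem alpha_mul_choose {N t m n : ℕ} (htm : t ≤ m) (hmn : m ≤ n) (hn : n ≤ N) :
    alpha N t m n * (N.choose n * N.choose m) =
      (N + 1).choose (n + m + 1 - t) * (N + 1).choose t := by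
  obtain ⟨i, rfl⟩ := Nat.exists_eq_add_of_le htm
  have e1 : (ascPochhammer ℝ i).eval ((n : ℝ) - N) =
      (-1) ^ i * ((N - n).descFactorial i : ℝ) := by
    rw [← descPochhammer_eval_eq_descFactorial, ← ascPochhammer_eval_neg_eq_descPochhammer,
      Nat.cast_sub hn, neg_sub]
  have e2 : (ascPochhammer ℝ i).eval ((n : ℝ) + 2) = ((n + 1 + 1).ascFactorial i : ℝ) := by
    rw [← ascPochhammer_nat_eq_natCast_ascFactorial]
    push_cast
    ring_nf
  have e3 : (ascPochhammer ℝ t).eval ((N : ℝ) + 2 - t) =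
      (t.factorial * (N + 1).choose t : ℝ) := by
    have h : (N : ℝ) + 2 - t = ((N + 2 - t : ℕ) : ℝ) := by
      rw [Nat.cast_sub (by omega)]
      push_cast
      ring
    rw [h, ascPochhammer_nat_eq_natCast_descFactorial, show N + 2 - t + t - 1 = N + 1 by omega,
      Nat.descFactorial_eq_factorial_mul_choose]
    push_cast
    ring
  have h1 : ((N + 1) * N.choose n : ℝ) = (N + 1).choose (n + 1) * (n + 1) := by
    exact_mod_cast Nat.add_one_mul_choose_eq N n
  have h2 : ((N + 1).choose (n + 1) * (N - n).descFactorial i : ℝ) =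
      (N + 1).choose (n + 1 + i) * (n + 1 + 1).ascFactorial i := by
    have h := choose_mul_descFactorial (N + 1) (n + 1) i
    rw [Nat.add_sub_add_right] at h
    exact_mod_cast h
  have h3 : (N.choose (t + i) * (t + i).factorial * (N - (t + i)).factorial : ℝ) =
      N.factorial := by
    exact_mod_cast Nat.choose_mul_factorial_mul_factorial (show t + i ≤ N by omega)
  rw [alpha, Nat.add_sub_cancel_left, e1, e2, e3,
    show n + (t + i) + 1 - t = n + 1 + i by omega]
  have k1 : (N.factorial : ℝ) ≠ 0 := Nat.cast_ne_zero.mpr N.factorial_ne_zero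
  have k2 : ((n + 1 + 1).ascFactorial i : ℝ) ≠ 0 :=
    Nat.cast_ne_zero.mpr (Nat.ascFactorial_pos _ _).ne'
  have k3 : (n : ℝ) + 1 ≠ 0 := by positivity
  have k4 : (t.factorial : ℝ) ≠ 0 := Nat.cast_ne_zero.mpr t.factorial_ne_zero
  have k5 : ((-1 : ℝ) ^ i) * (-1) ^ i = 1 := by rw [← mul_pow]; simp
  have h4 : ((N + 1).choose (n + 1 + i) : ℝ) =
      (N + 1) * N.choose n / (n + 1) * (N - n).descFactorial i / (n + 1 + 1).ascFactorial i := by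
    rw [h1, mul_div_cancel_right₀ _ k3, h2, mul_div_cancel_right₀ _ k2]
  rw [h4, ← h3]
  rw [← h3] at k1
  calc _ = ((-1 : ℝ) ^ i * (-1) ^ i) * ((N + 1) * N.choose n / (n + 1) * (N - n).descFactorial i /
        (n + 1 + 1).ascFactorial i * (N + 1).choose t) *
        ((N.choose (t + i) * (t + i).factorial * (N - (t + i)).factorial : ℝ) /
          (N.choose (t + i) * (t + i).factorial * (N - (t + i)).factorial)) *
        (t.factorial / t.factorial) := by ring
    _ = _ := by rw [k5, div_self k1, div_self k4]; ring

/-! ### Factorization and determinant of the weight -/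

/-- The diagonal matrix of inverse binomial coefficients. -/
noncomputable def invChoose (N : ℕ) : Matrix (Fin (N + 1)) (Fin (N + 1)) ℂ :=
  Matrix.diagonal fun k => ((N.choose (k : ℕ) : ℂ))⁻¹

theorem choose_ne_zero {N : ℕ} (k : Fin (N + 1)) : (N.choose (k : ℕ) : ℂ) ≠ 0 :=
  Nat.cast_ne_zero.mpr (Nat.choose_pos (Nat.lt_succ_iff.mp k.2)).ne'

theorem det_invChoose_ne_zero (N : ℕ) : (invChoose N).det ≠ 0 := by
  rw [invChoose, Matrix.det_diagonal]
  exact Finset.prod_ne_zero_iff.mpr fun k _ => inv_ne_zero (choose_ne_zero k)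

open Complex in
theorem exp_sub_exp_neg (w : ℂ) : exp (I * w) - exp (-(I * w)) = 2 * I * sin w := by
  rw [sin, show -(I * w) = -w * I by ring, show I * w = w * I by ring]
  linear_combination (exp (w * I) - exp (-w * I)) * I_sq

open Complex in
theorem exp_sub_exp_neg_ne_zero {θ : ℝ} (hθ : Real.sin θ ≠ 0) :
    exp (I * θ) - exp (-(I * θ)) ≠ 0 := by
  rw [exp_sub_exp_neg, ← ofReal_sin]
  exact mul_ne_zero (mul_ne_zero two_ne_zero I_ne_zero) (ofReal_ne_zero.mpr hθ)

open Complex in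
-- This is sin θ · U_{s-t}(cos θ) = sin((s-t+1)θ) in exponential form, using e^{iθ} e^{-iθ} = 1 to
-- distribute the exponent.
theorem sub_exp_mul_chebyshev_U (θ : ℝ) (s t : ℕ) :
    (exp (I * θ) - exp (-(I * θ))) *
        ((Polynomial.Chebyshev.U ℝ ((s : ℤ) - t)).eval (Real.cos θ) : ℝ) =
      exp (I * θ) ^ (s + 1) * exp (-(I * θ)) ^ t - exp (-(I * θ)) ^ (s + 1) * exp (I * θ) ^ t := by
  have h := congrArg (fun r : ℝ => (r : ℂ)) (Polynomial.Chebyshev.U_real_cos θ ((s : ℤ) - t))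
  push_cast at h ⊢
  rw [exp_sub_exp_neg, mul_assoc, mul_comm (sin _), h, ← exp_sub_exp_neg, ← exp_nat_mul, ← exp_nat_mul, ← exp_nat_mul,
    ← exp_nat_mul, ← exp_add, ← exp_add]
  push_cast
  ring_nf

open Complex in
theorem weightLower_cos {N n m : ℕ} {θ : ℝ} (hθ : 0 < Real.sin θ) (hmn : m ≤ n) (hn : n ≤ N) :
    (weightLower N n m (Real.cos θ) : ℂ) * (N.choose n * N.choose m) =
      Real.sin θ * kernelCoeff N (exp (I * θ)) (exp (-(I * θ))) n m := by
  have hs : Real.sqrt (1 - Real.cos θ ^ 2) = Real.sin θ := by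
    rw [← Real.sin_sq, Real.sqrt_sq hθ.le]
  refine mul_left_cancel₀ (exp_sub_exp_neg_ne_zero hθ.ne') ?_
  rw [mul_left_comm _ (Real.sin θ : ℂ), kernelCoeff_eq_sum, weightLower, hs]
  push_cast
  rw [mul_assoc (sin (θ : ℂ)), mul_left_comm _ (sin (θ : ℂ)), Finset.sum_mul, Finset.mul_sum]
  congr 1
  refine Finset.sum_congr rfl fun t ht => ?_
  have htm : t ≤ m := Nat.lt_succ_iff.mp (Finset.mem_range.mp ht)
  have ha := congrArg (fun r : ℝ => (r : ℂ)) (alpha_mul_choose htm hmn hn)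
  have hU := sub_exp_mul_chebyshev_U θ (n + m - t) t
  have hidx : ((n + m - t : ℕ) : ℤ) - t = (n : ℤ) + m - 2 * t := by omega
  rw [hidx, show n + m - t + 1 = n + m + 1 - t by omega] at hU
  push_cast at ha hU
  rw [← hU, ← ha]
  ring

open Complex in
theorem W_cos {N : ℕ} {θ : ℝ} (hθ : 0 < Real.sin θ) :
    W N (Real.cos θ) = (Real.sin θ : ℂ) • (invChoose N *
      ((symPow N (exp (I * θ)) (exp (-(I * θ)))).transpose *
        symPow N (exp (-(I * θ))) (exp (I * θ))) * invChoose N) := by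
  ext n m
  have hn : (n : ℕ) ≤ N := Nat.lt_succ_iff.mp n.2
  have hm : (m : ℕ) ≤ N := Nat.lt_succ_iff.mp m.2
  have key : W N (Real.cos θ) n m * (N.choose n * N.choose m) =
      Real.sin θ * kernelCoeff N (exp (I * θ)) (exp (-(I * θ))) n m := by
    rw [W, Matrix.of_apply]
    split_ifs with h
    · exact weightLower_cos hθ h hn
    · rw [kernelCoeff_comm, mul_comm (N.choose n : ℂ)]
      exact weightLower_cos hθ (not_le.mp h).le hm
  rw [Matrix.smul_apply, smul_eq_mul, invChoose, Matrix.mul_diagonal, Matrix.diagonal_mul,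
    symPow_transpose_mul_apply]
  have h1 := choose_ne_zero n
  have h2 := choose_ne_zero m
  refine mul_right_cancel₀ (mul_ne_zero h1 h2) ?_
  rw [key]
  field_simp

open Complex in
theorem det_W_cos {N : ℕ} {θ : ℝ} (hθ : 0 < Real.sin θ) :
    (W N (Real.cos θ)).det =
      ((Real.sin θ ^ ((N + 1) ^ 2) * ∏ k ∈ Finset.range (N + 1), c N k : ℝ) : ℂ) := by
  have h4 : (exp (I * θ) - exp (-(I * θ))) * (exp (-(I * θ)) - exp (I * θ)) =
      4 * (Real.sin θ : ℂ) ^ 2 := by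
    rw [← neg_sub (exp (I * θ)), exp_sub_exp_neg, ofReal_sin]
    linear_combination (-4 * sin (θ : ℂ) ^ 2) * I_sq
  have hdet : (invChoose N).det * (invChoose N).det =
      ((∏ k ∈ Finset.range (N + 1), ((N.choose k : ℝ) ^ 2)⁻¹ : ℝ) : ℂ) := by
    rw [invChoose, Matrix.det_diagonal, ← Finset.prod_mul_distrib, Finset.prod_range]
    push_cast
    refine Finset.prod_congr rfl fun k _ => ?_
    rw [sq, mul_inv]
  -- N + 1 factors sin θ come from the scalar, and each of the N(N+1)/2 factors (p-q)(q-p) = 4 sin²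
  -- θ gives two more.
  have hexp : (N + 1) ^ 2 = N + 1 + 2 * (N * (N + 1) / 2) := by
    rw [Nat.mul_div_cancel' (Nat.even_mul_succ_self N).two_dvd]
    ring
  rw [W_cos hθ, Matrix.det_smul, Matrix.det_mul, Matrix.det_mul, Matrix.det_mul,
    Matrix.det_transpose, det_symPow, det_symPow, ← mul_pow, h4, prod_c, Fintype.card_fin,
    mul_right_comm, hdet, hexp, pow_add _ (N + 1), pow_mul, mul_pow]
  push_cast
  ring

theorem c_pos (N k : ℕ) : 0 < c N k := by
  unfold c
  positivity

theorem W_eq_zero (N : ℕ) {x : ℝ} (hx : 1 - x ^ 2 = 0) : W N x = 0 := by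
  ext n m
  simp [W, weightLower, hx]

theorem det_W {N : ℕ} {x : ℝ} (hx : x ∈ Set.Icc (-1 : ℝ) 1) :
    (W N x).det = (((1 - x ^ 2) ^ (2 * ((N : ℝ) / 2 + 1 / 2) ^ 2 : ℝ) *
      ∏ k ∈ Finset.range (N + 1), c N k : ℝ) : ℂ) := by
  have hcos := Real.cos_arccos hx.1 hx.2
  rcases (Real.sin_nonneg_of_mem_Icc
    ⟨Real.arccos_nonneg x, Real.arccos_le_pi x⟩).eq_or_lt with h0 | hpos
  -- At the endpoints the square root kills W, and the right side vanishes because the exponent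
  -- (N+1)²/2 is positive, even for N = 0.
  · have hx0 : 1 - x ^ 2 = 0 := by
      rw [← hcos, ← Real.sin_sq, ← h0]
      simp
    rw [W_eq_zero N hx0, hx0, Real.zero_rpow (by positivity), Matrix.det_zero]
    simp
  · have h := det_W_cos (N := N) hpos
    rw [hcos] at h
    rw [h, ← hcos, ← Real.sin_sq, hcos, ← Real.rpow_natCast _ 2, ← Real.rpow_mul hpos.le,
      ← Real.rpow_natCast _ ((N + 1) ^ 2)]
    congr 4
    push_cast
    ring

theorem isUnit_W {N : ℕ} {x : ℝ} (hx : x ∈ Set.Icc (-1 : ℝ) 1) (h1 : x ≠ -1) (h2 : x ≠ 1) :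
    IsUnit (W N x) := by
  rw [Matrix.isUnit_iff_isUnit_det, det_W hx, isUnit_iff_ne_zero, Complex.ofReal_ne_zero]
  have hx1 : 0 < 1 - x ^ 2 := by
    have h3 : -1 < x := lt_of_le_of_ne hx.1 h1.symm
    have h4 : x < 1 := lt_of_le_of_ne hx.2 h2
    nlinarith
  exact mul_ne_zero (Real.rpow_pos_of_pos hx1 _).ne'
    (Finset.prod_ne_zero_iff.mpr fun k _ => (c_pos N k).ne')

/-! ### The full spherical function -/

open Polynomial in
theorem coeff_symPow_factors (n m : ℕ) (p q : ℂ) (i : ℕ) :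
    ((1 + C p * X : ℂ[X]) ^ n * (1 + C q * X) ^ m).coeff i =
      ∑ j : Fin (n + 1), ∑ k : Fin (m + 1), if (j : ℕ) + k = i then
        (n.choose j * p ^ (j : ℕ)) * (m.choose k * q ^ (k : ℕ)) else 0 := by
  have h : ∀ (r : ℂ) (M : ℕ), (1 + C r * X : ℂ[X]) ^ M =
      ∑ j : Fin (M + 1), monomial (j : ℕ) ((M.choose j : ℂ) * r ^ (j : ℕ)) := by
    intro r M
    rw [add_comm, add_pow, Finset.sum_range]
    refine Finset.sum_congr rfl fun j _ => ?_
    rw [← C_mul_X_pow_eq_monomial]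
    simp only [mul_pow, one_pow, mul_one, C_mul, C_pow, map_natCast]
    ring
  rw [h, h, Finset.sum_mul_sum]
  simp only [monomial_mul_monomial, finsetSum_coeff, coeff_monomial]

theorem T_torus_mono (N : ℕ) (s : ℝ) (k : Fin (N + 1)) :
    T N (torus s) (mono N k) =
      (Complex.exp (Complex.I * s) ^ (N - (k : ℕ)) * Complex.exp (-(Complex.I * s)) ^ (k : ℕ)) •
        mono N k := by
  apply Subtype.ext
  have h : MvPolynomial.monomial (expo N k) (1 : ℂ) =
      MvPolynomial.X 0 ^ (N - (k : ℕ)) * MvPolynomial.X 1 ^ (k : ℕ) := by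
    rw [MvPolynomial.X_pow_eq_monomial, MvPolynomial.X_pow_eq_monomial,
      MvPolynomial.monomial_mul, one_mul, expo]
  rw [T_coe, Submodule.coe_smul]
  simp only [mono]
  rw [h]
  simp [subst, torus, smul_pow, smul_smul, mul_comm]

theorem mono_mul_mono {n m N : ℕ} (h : n + m = N) (j : Fin (n + 1)) (k : Fin (m + 1)) :
    (mono n j).1 * (mono m k).1 = MvPolynomial.monomial (expo N (j + k)) (1 : ℂ) := by
  have hj : (j : ℕ) ≤ n := Nat.lt_succ_iff.mp j.2
  have hk : (k : ℕ) ≤ m := Nat.lt_succ_iff.mp k.2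
  simp only [mono, MvPolynomial.monomial_mul, one_mul]
  refine congrArg (fun d => MvPolynomial.monomial d (1 : ℂ)) (Finsupp.ext fun i => ?_)
  fin_cases i
  · simp [expo]
    omega
  · simp [expo]

theorem pow_sub_mul_pow_eq {u w : ℂ} (huw : u * w = 1) {n j : ℕ} (hj : j ≤ n) :
    u ^ (n - j) * w ^ j = u ^ n * (w ^ 2) ^ j := by
  obtain ⟨i, rfl⟩ := Nat.exists_eq_add_of_le hj
  rw [Nat.add_sub_cancel_left, pow_add,
    show u ^ j * u ^ i * (w ^ 2) ^ j = (u * w) ^ j * (u ^ i * w ^ j) by ring, huw, one_pow, one_mul]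

/-- Polarization spreads x^{N-i} y^i over the tensors with j + k = i, with weights C(n,j) C(N-n,k) /
C(N,i). The torus scales each tensor, and multiplication maps it back to x^{N-i} y^i. Passing from x
to y multiplies the torus eigenvalue by e^{-it} in the first factor and by e^{it} in the second.
Hence the i-th coefficient of (1 + e^{-it}X)^n (1 + e^{it}X)^(N-n) appears, up to a scalar depending
only on n and the factor 1 / C(N,i). -/
theorem fullSpherical_eq (N : ℕ) (t : ℝ) :
    fullSpherical N t = Matrix.diagonal (fun n : Fin (N + 1) =>
        Complex.exp (Complex.I * (t / 2 : ℝ)) ^ (n : ℕ) *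
          Complex.exp (Complex.I * (-(t / 2) : ℝ)) ^ (N - (n : ℕ))) *
      symPow N (Complex.exp (-(Complex.I * t))) (Complex.exp (Complex.I * t)) * invChoose N := by
  ext n i
  rw [invChoose, Matrix.mul_diagonal, Matrix.diagonal_mul, fullSpherical, Matrix.of_apply,
    symPow, Matrix.of_apply, coeff_symPow_factors,
    spherical, LinearMap.comp_apply, LinearMap.comp_apply, emb_apply]
  simp only [map_sum, map_smul, aElt, T₂_tmul, T_torus_mono, TensorProduct.smul_tmul_smul]
  simp only [Submodule.coe_sum, Submodule.coe_smul, MvPolynomial.coeff_sum,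
    MvPolynomial.coeff_smul, proj_tmul, Finset.mul_sum, Finset.sum_mul, smul_eq_mul]
  refine Finset.sum_congr rfl fun j _ => Finset.sum_congr rfl fun k _ => ?_
  have hn := Nat.add_sub_of_le (Nat.lt_succ_iff.mp n.2)
  rw [mono_mul_mono hn]
  simp only [mono, MvPolynomial.coeff_monomial, mul_ite, ite_mul, mul_zero, zero_mul, mul_one]
  by_cases hi : (j : ℕ) + k = i
  · have huw : Complex.exp (Complex.I * (t / 2 : ℝ)) *
        Complex.exp (-(Complex.I * (t / 2 : ℝ))) = 1 := by
      rw [← Complex.exp_add]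
      simp
    have e1 : Complex.exp (Complex.I * t) = Complex.exp (Complex.I * (t / 2 : ℝ)) ^ 2 := by
      rw [← Complex.exp_nat_mul]
      push_cast
      ring_nf
    have e2 : Complex.exp (-(Complex.I * t)) = Complex.exp (-(Complex.I * (t / 2 : ℝ))) ^ 2 := by
      rw [← Complex.exp_nat_mul]
      push_cast
      ring_nf
    have e3 : Complex.I * (-(t / 2) : ℝ) = -(Complex.I * (t / 2 : ℝ)) := by
      push_cast
      ring
    rw [if_pos hi, if_pos (congrArg (expo N) hi), e3, neg_neg,
      pow_sub_mul_pow_eq huw (Nat.lt_succ_iff.mp j.2),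
      pow_sub_mul_pow_eq ((mul_comm _ _).trans huw) (Nat.lt_succ_iff.mp k.2), e1, e2, hi, if_pos rfl]
    ring
  · rw [if_neg hi, if_neg fun h => hi (expo_injective h)]

theorem isUnit_fullSpherical {N : ℕ} {t : ℝ} (h1 : Real.cos t ≠ -1) (h2 : Real.cos t ≠ 1) :
    IsUnit (fullSpherical N t) := by
  have hs : Real.sin t ≠ 0 := by
    intro h
    rcases Real.sin_eq_zero_iff_cos_eq.mp h with h | h
    exacts [h2 h, h1 h]
  rw [Matrix.isUnit_iff_isUnit_det, isUnit_iff_ne_zero, fullSpherical_eq, Matrix.det_mul,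
    Matrix.det_mul, Matrix.det_diagonal, det_symPow, ← neg_sub]
  refine mul_ne_zero (mul_ne_zero (Finset.prod_ne_zero_iff.mpr fun n _ => ?_)
    (pow_ne_zero _ (neg_ne_zero.mpr (exp_sub_exp_neg_ne_zero hs)))) (det_invChoose_ne_zero N)
  exact mul_ne_zero (pow_ne_zero _ (Complex.exp_ne_zero _)) (pow_ne_zero _ (Complex.exp_ne_zero _))

end MVChebyshev

theorem corollary2p3 (N : ℕ) :
    (∀ x ∈ Set.Icc (-1 : ℝ) 1,
      (MVChebyshev.W N x).det =
        (((1 - x ^ 2) ^ (2 * ((N : ℝ) / 2 + 1 / 2) ^ 2 : ℝ) *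
          ∏ k ∈ Finset.range (N + 1), MVChebyshev.c N k : ℝ) : ℂ)) ∧
    (∀ x ∈ Set.Icc (-1 : ℝ) 1, x ≠ -1 → x ≠ 1 → IsUnit (MVChebyshev.W N x)) ∧
    (∀ t : ℝ, Real.cos t ≠ -1 → Real.cos t ≠ 1 → IsUnit (MVChebyshev.fullSpherical N t)) := by
  exact ⟨fun _ => MVChebyshev.det_W, fun _ => MVChebyshev.isUnit_W,
    fun _ => MVChebyshev.isUnit_fullSpherical⟩
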